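/- Let $\mathfrak{g}$ be a finite-dimensional Lie algebra over the field $\mathbb{C}$ of complex numbers, and let $\langle\cdot,\cdot\rangle$ be a symmetric ($\mathbb{C}$-)bilinear form on $\mathfrak{g}$. Let $\mathrm{Inn}(\mathfrak{g})$ be the adjoint group of $\mathfrak{g}$, that is, the subgroup of $\mathrm{Aut}(\mathfrak{g})$ generated by all $\exp(\mathrm{ad}(X))$ with $X\in\mathfrak{g}$, and let $\overline{\mathrm{Inn}(\mathfrak{g})}$ be its Zariski closure in the complex algebraic group $\mathrm{Aut}(\mathfrak{g})$. Suppose that $\langle\cdot,\cdot\rangle$ is nil-invariant, which means that $$\langle\varphi X_1,X_2\rangle=-\langle X_1,\varphi X_2\rangle\qquad\text{for all }X_1,X_2\in\mathfrak{g}$$ and for every nilpotent element $\varphi$ of the Lie algebra of $\overline{\mathrm{Inn}(\mathfrak{g})}$. Then $\langle\cdot,\cdot\rangle$ is invariant, that is, $$\langle[X,Y],Z\rangle=-\langle Y,[X,Z]\rangle\qquad\text{for all }X,Y,Z\in\mathfrak{g}.$$ -/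

import Mathlib

open scoped Matrix

namespace NilInvariant

noncomputable section

variable {V : Type*} [AddCommGroup V] [Module ℂ V] [FiniteDimensional ℂ V]

/-- The matrix of an endomorphism in a fixed basis of `V`. The notions below do not depend on
the basis, since matrix exponentials and polynomial functions are compatible with conjugation. -/
def coord (V : Type*) [AddCommGroup V] [Module ℂ V] [FiniteDimensional ℂ V] :
    Module.End ℂ V ≃ₐ[ℂ]
      Matrix (Fin (Module.finrank ℂ V)) (Fin (Module.finrank ℂ V)) ℂ :=
  LinearMap.toMatrixAlgEquiv (Module.finBasis ℂ V)

/-- The matrix exponential, as an invertible matrix. -/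
def matrixExp {n : ℕ} (A : Matrix (Fin n) (Fin n) ℂ) : (Matrix (Fin n) (Fin n) ℂ)ˣ where
  val := NormedSpace.exp A
  inv := NormedSpace.exp (-A)
  val_inv := by
    rw [← Matrix.exp_add_of_commute _ _ (Commute.refl A).neg_right, add_neg_cancel,
      NormedSpace.exp_zero]
  inv_val := by
    rw [← Matrix.exp_add_of_commute _ _ (Commute.refl A).neg_left, neg_add_cancel,
      NormedSpace.exp_zero]

/-- The exponential `exp D` in `GL(V)` of an endomorphism `D` of `V`. -/
def expGL (D : Module.End ℂ V) : LinearMap.GeneralLinearGroup ℂ V :=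
  Units.map ((coord V).symm : _ →* Module.End ℂ V) (matrixExp (coord V D))

/-- The Zariski closure in `GL(V)` of a subset `S`: all `g` at which every polynomial in the
matrix entries that vanishes on `S` vanishes as well. (Inverting the determinant does not give
more closed sets.) -/
def zariskiClosure (S : Set (LinearMap.GeneralLinearGroup ℂ V)) :
    Set (LinearMap.GeneralLinearGroup ℂ V) :=
  {g | ∀ p : MvPolynomial (Fin (Module.finrank ℂ V) × Fin (Module.finrank ℂ V)) ℂ,
    (∀ s ∈ S, MvPolynomial.eval
      (fun ij => coord V (s : Module.End ℂ V) ij.1 ij.2) p = 0) →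
    MvPolynomial.eval (fun ij => coord V (g : Module.End ℂ V) ij.1 ij.2) p = 0}

/-- The Lie algebra of a complex algebraic (more generally, closed complex Lie) subgroup `G` of
`GL(V)`: all `D` whose one-parameter group `t ↦ exp (t D)`, `t ∈ ℂ`, lies in `G`. -/
def lieAlgebraOf (G : Set (LinearMap.GeneralLinearGroup ℂ V)) : Set (Module.End ℂ V) :=
  {D | ∀ t : ℂ, expGL (t • D) ∈ G}

/-- The adjoint group `Inn(L)`: the subgroup of `GL(L)` generated by all `exp (ad X)`. It
consists of automorphisms of the Lie algebra `L`. -/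
def Inn (L : Type*) [LieRing L] [LieAlgebra ℂ L] [FiniteDimensional ℂ L] :
    Subgroup (LinearMap.GeneralLinearGroup ℂ L) :=
  Subgroup.closure (Set.range fun X : L => expGL (LieAlgebra.ad ℂ L X))

/-- A bilinear form on `L` is nil-invariant if every nilpotent element of the Lie algebra of the
Zariski closure of `Inn(L)` is skew for it. The closure is taken in `GL(L)`; the automorphism
group of `L` is Zariski closed there, so this is also the closure in `Aut(L)`. -/
def IsNilInvariant {L : Type*} [LieRing L] [LieAlgebra ℂ L] [FiniteDimensional ℂ L]
    (B : LinearMap.BilinForm ℂ L) : Prop :=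
  ∀ φ ∈ lieAlgebraOf (zariskiClosure (Inn L : Set (LinearMap.GeneralLinearGroup ℂ L))),
    IsNilpotent φ → ∀ x y : L, B (φ x) y = -B x (φ y)

end

end NilInvariant

/-!
Fix `x : L` and let `ad x = n + s` be its Jordan decomposition, `n` nilpotent and `s` semisimple.
It suffices that `n` and `s` are both skew for the form.

*The nilpotent part.* The matrix entries of `exp (t n + w s)` are sums of polynomials in `t` times
exponentials `e^{μ w}`, with `μ` an eigenvalue of `s`. If a polynomial `p` in the matrix entries
vanishes on all `exp (z (n + s))`, then `p (exp (z n + z s))` is an exponential polynomial in `z`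
that vanishes identically. Exponential polynomials with distinct exponents are linearly independent
(`NilInvariant.expPoly_eq_zero`), so `p (exp (t n + w s))` vanishes formally, and setting `w = 0`
shows that `exp (t n)` lies in the Zariski closure
(`NilInvariant.nilpotent_part_mem_lieAlgebraOf`). Nil-invariance then applies to `n`.

*The semisimple part.* Let `L_α` be the generalized eigenspaces of `ad x`, so that
`[L_α, L_β] ⊆ L_(α+β)`. For `α ≠ 0` every `a ∈ L_α` is ad-nilpotent, so that `ad a` is skew, and
`a = [x, a']` for some `a' ∈ L_α`. Hence `⟨x, a⟩ = -⟨x, [a', x]⟩ = ⟨[a', x], x⟩`, which gives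
`⟨x, L_α⟩ = 0` by symmetry. If moreover `b ∈ L_β` with `α + β ≠ 0`, then
`⟨a, b⟩ = -⟨[a', x], b⟩ = ⟨x, [a', b]⟩ = 0` because `[a', b] ∈ L_(α+β)`. So `L_α` and `L_β` are
orthogonal unless `α + β = 0` (`NilInvariant.maxGenEigenspace_orthogonal`), which says that `s`
is skew (`NilInvariant.semisimple_part_skew`). No Levi decomposition is needed.
-/

namespace NilInvariant

/-! ### Orthogonality of the generalized eigenspaces of `ad x` -/

section Lie

open Module Module.End

variable {L : Type*} [LieRing L] [LieAlgebra ℂ L] [FiniteDimensional ℂ L]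

omit [FiniteDimensional ℂ L] in
lemma ad_pow_apply_mem_maxGenEigenspace {x a y : L} {α β : ℂ}
    (ha : a ∈ (LieAlgebra.ad ℂ L x).maxGenEigenspace α)
    (hy : y ∈ (LieAlgebra.ad ℂ L x).maxGenEigenspace β) (k : ℕ) :
    ((LieAlgebra.ad ℂ L a) ^ k) y ∈ (LieAlgebra.ad ℂ L x).maxGenEigenspace (k * α + β) := by
  induction k with
  | zero => simpa using hy
  | succ k ih =>
    have h : ⁅a, ((LieAlgebra.ad ℂ L a) ^ k) y⁆
        ∈ (LieAlgebra.ad ℂ L x).maxGenEigenspace (α + (k * α + β)) :=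
      LieModule.lie_mem_maxGenEigenspace_toEnd (R := ℂ) (x := x) ha ih
    rw [pow_succ', Module.End.mul_apply, LieAlgebra.ad_apply]
    convert h using 2
    push_cast
    ring

/-- Bracketing with `a` shifts generalized eigenvalues of `ad x` by `α ≠ 0`, and there are only
finitely many of these. -/
lemma isNilpotent_ad_of_mem_maxGenEigenspace {x a : L} {α : ℂ} (hα : α ≠ 0)
    (ha : a ∈ (LieAlgebra.ad ℂ L x).maxGenEigenspace α) :
    IsNilpotent (LieAlgebra.ad ℂ L a) := by
  have htop : (LieAlgebra.ad ℂ L a).maxGenEigenspace 0 = ⊤ := by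
    rw [eq_top_iff, ← iSup_maxGenEigenspace_eq_top (LieAlgebra.ad ℂ L x), iSup_le_iff]
    intro β y hy
    have hfin : {γ | (LieAlgebra.ad ℂ L x).maxGenEigenspace γ ≠ ⊥}.Finite :=
      WellFoundedGT.finite_ne_bot_of_iSupIndep (independent_maxGenEigenspace _)
    have hinj : Function.Injective fun k : ℕ => (k : ℂ) * α + β := fun k l h => by
      simpa [hα] using h
    obtain ⟨k, hk⟩ := (hfin.preimage hinj.injOn).exists_notMem
    have hbot : (LieAlgebra.ad ℂ L x).maxGenEigenspace (k * α + β) = ⊥ := by simpa using hk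
    have hmem := ad_pow_apply_mem_maxGenEigenspace ha hy k
    rw [hbot, Submodule.mem_bot] at hmem
    exact (mem_maxGenEigenspace _ _ _).2 ⟨k, by simpa using hmem⟩
  refine ⟨finrank ℂ L, LinearMap.ext fun y => ?_⟩
  have hy : y ∈ (LieAlgebra.ad ℂ L a).maxGenEigenspace 0 := htop ▸ Submodule.mem_top
  rw [maxGenEigenspace_eq_genEigenspace_finrank, mem_genEigenspace_nat] at hy
  simpa using hy

/-- On its generalized eigenspace for a nonzero eigenvalue, an endomorphism is surjective. -/
lemma exists_mem_maxGenEigenspace_apply_eq {K V : Type*} [Field K] [AddCommGroup V]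
    [Module K V] [FiniteDimensional K V] (f : End K V) {α : K} (hα : α ≠ 0) {v : V}
    (hv : v ∈ f.maxGenEigenspace α) : ∃ w ∈ f.maxGenEigenspace α, f w = v := by
  have hmaps := f.mapsTo_maxGenEigenspace_of_comm (Commute.refl f) α
  have hinj : Function.Injective (f.restrict hmaps) := by
    rw [← LinearMap.ker_eq_bot, LinearMap.ker_eq_bot']
    rintro ⟨w, hw⟩ h
    have h0 : f w = 0 := congrArg Subtype.val h
    have hw0 : w ∈ f.maxGenEigenspace 0 := eigenspace_le_maxGenEigenspace (by simpa using h0)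
    have hdis : Disjoint (f.maxGenEigenspace α) (f.maxGenEigenspace 0) :=
      disjoint_genEigenspace f hα ⊤ ⊤
    exact Subtype.ext (Submodule.disjoint_def.1 hdis w hw hw0)
  obtain ⟨⟨w, hw⟩, h⟩ := LinearMap.injective_iff_surjective.1 hinj ⟨v, hv⟩
  exact ⟨w, hw, congrArg Subtype.val h⟩

lemma apply_eq_zero_of_mem_maxGenEigenspace {B : LinearMap.BilinForm ℂ L}
    (hB : ∀ a : L, IsNilpotent (LieAlgebra.ad ℂ L a) → ∀ x y, B ⁅a, x⁆ y = -B x ⁅a, y⁆)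
    (hsymm : B.IsSymm) {x c : L} {γ : ℂ} (hγ : γ ≠ 0)
    (hc : c ∈ (LieAlgebra.ad ℂ L x).maxGenEigenspace γ) : B x c = 0 := by
  obtain ⟨c', hc', rfl⟩ := exists_mem_maxGenEigenspace_apply_eq _ hγ hc
  have h := hB c' (isNilpotent_ad_of_mem_maxGenEigenspace hγ hc') x x
  have hs : B ⁅c', x⁆ x = B x ⁅c', x⁆ := hsymm.eq _ _
  have h2 : B x ⁅c', x⁆ = 0 := by
    linear_combination (h - hs) / 2
  rw [LieAlgebra.ad_apply, ← lie_skew, map_neg, h2, neg_zero]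

lemma maxGenEigenspace_orthogonal_of_ne_zero {B : LinearMap.BilinForm ℂ L}
    (hB : ∀ a : L, IsNilpotent (LieAlgebra.ad ℂ L a) → ∀ x y, B ⁅a, x⁆ y = -B x ⁅a, y⁆)
    (hsymm : B.IsSymm) {x a b : L} {α β : ℂ}
    (hα : α ≠ 0) (hαβ : α + β ≠ 0) (ha : a ∈ (LieAlgebra.ad ℂ L x).maxGenEigenspace α)
    (hb : b ∈ (LieAlgebra.ad ℂ L x).maxGenEigenspace β) : B a b = 0 := by
  obtain ⟨a', ha', rfl⟩ := exists_mem_maxGenEigenspace_apply_eq _ hα ha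
  have h1 := hB a' (isNilpotent_ad_of_mem_maxGenEigenspace hα ha') x b
  have h2 : B x ⁅a', b⁆ = 0 := apply_eq_zero_of_mem_maxGenEigenspace hB hsymm hαβ
    (LieModule.lie_mem_maxGenEigenspace_toEnd (R := ℂ) (x := x) ha' hb)
  rw [LieAlgebra.ad_apply, ← lie_skew, map_neg, LinearMap.neg_apply, h1, h2, neg_zero, neg_zero]

/-- The generalized eigenspaces of `ad x` for `α` and `β` are orthogonal unless `α + β = 0`. -/
lemma maxGenEigenspace_orthogonal {B : LinearMap.BilinForm ℂ L}
    (hB : ∀ a : L, IsNilpotent (LieAlgebra.ad ℂ L a) → ∀ x y, B ⁅a, x⁆ y = -B x ⁅a, y⁆)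
    (hsymm : B.IsSymm) {x a b : L} {α β : ℂ}
    (hαβ : α + β ≠ 0) (ha : a ∈ (LieAlgebra.ad ℂ L x).maxGenEigenspace α)
    (hb : b ∈ (LieAlgebra.ad ℂ L x).maxGenEigenspace β) : B a b = 0 := by
  by_cases hα : α = 0
  · have hβ : β ≠ 0 := by rintro rfl; simp [hα] at hαβ
    rw [← hsymm.eq]
    exact maxGenEigenspace_orthogonal_of_ne_zero hB hsymm hβ (by rwa [add_comm]) hb ha
  · exact maxGenEigenspace_orthogonal_of_ne_zero hB hsymm hα hαβ ha hb

lemma eigenspace_le_maxGenEigenspace_add {K V : Type*} [Field K] [AddCommGroup V] [Module K V]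
    {n s : End K V} (hn : IsNilpotent n) (hns : Commute n s) (α : K) :
    s.eigenspace α ≤ (n + s).maxGenEigenspace α := by
  intro v hv
  rw [mem_eigenspace_iff] at hv
  have key : ∀ k : ℕ, ((n + s - α • (1 : End K V)) ^ k) v = (n ^ k) v := by
    intro k
    induction k with
    | zero => rfl
    | succ k ih =>
      have hs : s ((n ^ k) v) = α • (n ^ k) v := by
        rw [← Module.End.mul_apply, ← (hns.pow_left k).eq, Module.End.mul_apply, hv, map_smul]
      rw [pow_succ', Module.End.mul_apply, ih, pow_succ', Module.End.mul_apply]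
      simp [hs]
  obtain ⟨k, hk⟩ := hn
  exact (mem_maxGenEigenspace _ _ _).2 ⟨k, by rw [key, hk, LinearMap.zero_apply]⟩

/-- The semisimple part of `ad x` is skew, since its eigenspaces for `α` and `β` are orthogonal
unless `α + β = 0`. -/
lemma semisimple_part_skew {B : LinearMap.BilinForm ℂ L}
    (hB : ∀ a : L, IsNilpotent (LieAlgebra.ad ℂ L a) → ∀ x y, B ⁅a, x⁆ y = -B x ⁅a, y⁆)
    (hsymm : B.IsSymm) {x : L} {n s : End ℂ L} (hn : IsNilpotent n) (hs : s.IsSemisimple)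
    (hns : Commute n s) (hx : LieAlgebra.ad ℂ L x = n + s) (y z : L) :
    B (s y) z = -B y (s z) := by
  have htop : ⨆ μ, s.eigenspace μ = ⊤ := hs.iSup_eigenspace_eq_top
  induction (htop ▸ Submodule.mem_top : y ∈ ⨆ μ, s.eigenspace μ) using
    Submodule.iSup_induction' with
  | zero => simp
  | add y₁ y₂ _ _ h₁ h₂ => simp only [map_add, LinearMap.add_apply, h₁, h₂]; ring
  | mem α y hy =>
    induction (htop ▸ Submodule.mem_top : z ∈ ⨆ μ, s.eigenspace μ) using
      Submodule.iSup_induction' with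
    | zero => simp
    | add z₁ z₂ _ _ h₁ h₂ => simp only [map_add, h₁, h₂]; ring
    | mem β z hz =>
      have hy' := hx ▸ eigenspace_le_maxGenEigenspace_add hn hns α hy
      have hz' := hx ▸ eigenspace_le_maxGenEigenspace_add hn hns β hz
      rw [mem_eigenspace_iff.1 hy, mem_eigenspace_iff.1 hz]
      simp only [map_smul, LinearMap.smul_apply, smul_eq_mul]
      by_cases h : α + β = 0
      · linear_combination B y z * h
      · rw [maxGenEigenspace_orthogonal hB hsymm h hy' hz']
        simp

end Lie

/-! ### Exponential polynomials -/

section Exponential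

open Module Polynomial

/-- Exponential polynomials with distinct exponents are linearly independent over `ℂ[X]`. -/
lemma expPoly_eq_zero (S : Finset ℂ) : ∀ q : ℂ → ℂ[X],
    (∀ z : ℂ, ∑ μ ∈ S, Complex.exp (μ * z) * (q μ).eval z = 0) → ∀ μ ∈ S, q μ = 0 := by
  induction S using Finset.induction_on with
  | empty => simp
  | insert μ S hμ ih =>
    intro q hq
    -- Divide by `exp (μ z)` and differentiate until the polynomial `q μ` has disappeared.
    have hder : ∀ N : ℕ, ∀ z : ℂ, (derivative^[N] (q μ)).eval z +
        ∑ ν ∈ S, Complex.exp ((ν - μ) * z) *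
          ((fun p : ℂ[X] => C (ν - μ) * p + derivative p)^[N] (q ν)).eval z = 0 := by
      intro N
      induction N with
      | zero =>
        intro z
        have h := hq z
        rw [Finset.sum_insert hμ] at h
        have h2 := congrArg (Complex.exp (-(μ * z)) * ·) h
        simp only [mul_add, mul_zero, Finset.mul_sum, ← mul_assoc, ← Complex.exp_add] at h2
        simp only [neg_add_cancel, Complex.exp_zero, one_mul] at h2
        simp only [Function.iterate_zero, id_eq]
        rw [← h2]
        congr 1
        refine Finset.sum_congr rfl fun ν _ => ?_
        congr 2
        ring
      | succ N ihN =>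
        intro z
        have h0 := (hasDerivAt_const z (0 : ℂ)).congr_of_eventuallyEq
          (Filter.Eventually.of_forall ihN)
        have h1 := (derivative^[N] (q μ)).hasDerivAt z |>.add
          (HasDerivAt.fun_sum (u := S) fun ν _ =>
            (((hasDerivAt_id z).const_mul (ν - μ)).cexp.mul
              (((fun p : ℂ[X] => C (ν - μ) * p + derivative p)^[N] (q ν)).hasDerivAt z)))
        have h2 := h1.unique h0
        rw [← h2]
        simp only [Function.iterate_succ_apply', eval_add, eval_mul, eval_C, id_eq, mul_one]
        congr 1
        refine Finset.sum_congr rfl fun ν _ => ?_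
        ring
    have hS : ∀ ν ∈ S, q ν = 0 := by
      intro ν hν
      have hνμ : ν - μ ≠ 0 := sub_ne_zero.2 fun h => hμ (h ▸ hν)
      have h := ih (fun ν => (fun p : ℂ[X] => C (ν - μ) * p + derivative p)^[
        (q μ).natDegree + 1] (q ν)) (fun z => ?_) ν hν
      · refine of_not_not fun hne => ?_
        -- `p ↦ c p + p'` preserves nonzero polynomials when `c ≠ 0`.
        have hpres : ∀ p : ℂ[X], p ≠ 0 → C (ν - μ) * p + derivative p ≠ 0 := by
          intro p hp h0
          have hlt := degree_derivative_lt hp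
          rw [← degree_neg, ← eq_neg_of_add_eq_zero_left h0, degree_C_mul hνμ] at hlt
          exact lt_irrefl _ hlt
        have : ∀ N : ℕ, (fun p : ℂ[X] => C (ν - μ) * p + derivative p)^[N] (q ν) ≠ 0 := by
          intro N
          induction N with
          | zero => exact hne
          | succ N ihN => rw [Function.iterate_succ_apply']; exact hpres _ ihN
        exact this _ h
      · have h2 := congrArg (Complex.exp (μ * z) * ·) (hder ((q μ).natDegree + 1) z)
        rw [iterate_derivative_eq_zero (Nat.lt_succ_self _)] at h2
        simp only [eval_zero, zero_add, mul_zero, Finset.mul_sum, ← mul_assoc,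
          ← Complex.exp_add] at h2
        rw [← h2]
        refine Finset.sum_congr rfl fun ν _ => ?_
        congr 2
        ring
    intro ν hν
    rcases Finset.mem_insert.1 hν with rfl | hν
    · refine Polynomial.funext fun z => ?_
      have h := hq z
      rw [Finset.sum_insert hμ, Finset.sum_eq_zero fun ν' hν' => by rw [hS ν' hν']; simp,
        add_zero] at h
      simpa [Complex.exp_ne_zero] using h
    · exact hS ν hν

/-- The formal exponential polynomials `∑ q_μ(z) e^{μ z}`, as the group algebra over `ℂ[X]` of the
additive group of exponents. -/
abbrev ExpPoly : Type := AddMonoidAlgebra ℂ[X] ℂ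

namespace ExpPoly

/-- The value of a formal exponential polynomial with `e^{μ w}` for the exponentials and `t` for
the variable of the coefficients. -/
noncomputable def eval₂ (w t : ℂ) : ExpPoly →+* ℂ :=
  AddMonoidAlgebra.liftNCRingHom (Polynomial.evalRingHom t)
    { toFun := fun μ => Complex.exp (μ.toAdd * w)
      map_one' := by simp
      map_mul' := fun μ ν => by simp [add_mul, Complex.exp_add] }
    (fun _ _ => Commute.all _ _)

lemma eval₂_single (w t μ : ℂ) (q : ℂ[X]) :
    eval₂ w t (AddMonoidAlgebra.single μ q) = q.eval t * Complex.exp (μ * w) := by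
  simp [eval₂]

lemma eval₂_eq_sum (w t : ℂ) (r : ExpPoly) :
    eval₂ w t r = r.coeff.sum fun μ q => Complex.exp (μ * w) * q.eval t := by
  induction r using AddMonoidAlgebra.induction_linear with
  | zero => simp
  | add f g hf hg =>
    rw [map_add, hf, hg, AddMonoidAlgebra.coeff_add,
      Finsupp.sum_add_index' (by simp) (by simp [mul_add])]
  | single μ q => simp [eval₂_single, mul_comm]

/-- A formal exponential polynomial that vanishes as a function is zero. -/
lemma eq_zero_of_eval₂_diag (r : ExpPoly) (h : ∀ z, eval₂ z z r = 0) : r = 0 := by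
  have hS := expPoly_eq_zero r.coeff.support (fun μ => r.coeff μ) fun z => by
    rw [← h z, eval₂_eq_sum, Finsupp.sum]
  refine AddMonoidAlgebra.coeff_injective (Finsupp.ext fun μ => ?_)
  by_cases hμ : μ ∈ r.coeff.support
  · exact hS μ hμ
  · simpa using hμ

lemma eval₂_aeval {σ : Type*} (w t : ℂ) (g : σ → ExpPoly) (p : MvPolynomial σ ℂ) :
    eval₂ w t (MvPolynomial.aeval g p) = MvPolynomial.eval (fun i => eval₂ w t (g i)) p := by
  have hC : (eval₂ w t).comp (algebraMap ℂ ExpPoly) = RingHom.id ℂ := by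
    ext c
    change eval₂ w t (AddMonoidAlgebra.single 0 (C c)) = c
    simp [eval₂_single]
  rw [MvPolynomial.map_aeval, hC]
  rfl

end ExpPoly

/-! ### The nilpotent part of an element of the Lie algebra of a Zariski closure -/

section JordanDecomposition

open scoped Nat

variable {V : Type*} [AddCommGroup V] [Module ℂ V] [FiniteDimensional ℂ V]

lemma expGL_add_of_commute {C D : End ℂ V} (h : Commute C D) :
    expGL (C + D) = expGL C * expGL D := by
  refine Units.ext ?_
  change (coord V).symm (NormedSpace.exp (coord V (C + D))) =
    (coord V).symm (NormedSpace.exp (coord V C)) * (coord V).symm (NormedSpace.exp (coord V D))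
  rw [map_add, Matrix.exp_add_of_commute _ _ (h.map (coord V)), map_mul]

/-- The exponential series, tested against a vector and a linear functional. -/
lemma hasSum_dual_expGL_apply (D : End ℂ V) (v : V) (ℓ : Dual ℂ V) :
    HasSum (fun k : ℕ => (k ! : ℂ)⁻¹ * ℓ ((D ^ k) v)) (ℓ ((expGL D : End ℂ V) v)) := by
  have hexp : HasSum (fun k : ℕ => (k ! : ℂ)⁻¹ • coord V D ^ k)
      (NormedSpace.exp (coord V D)) := by
    -- `NormedSpace.exp` depends only on the topology; any compatible norm gives convergence.
    let _ := Matrix.linftyOpNormedRing (n := Fin (finrank ℂ V)) (α := ℂ)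
    let _ := Matrix.linftyOpNormedAlgebra (n := Fin (finrank ℂ V)) (R := ℂ) (α := ℂ)
    exact NormedSpace.exp_series_hasSum_exp' (𝕂 := ℂ) (coord V D)
  let F : Matrix (Fin (finrank ℂ V)) (Fin (finrank ℂ V)) ℂ →ₗ[ℂ] ℂ :=
    ℓ ∘ₗ LinearMap.applyₗ v ∘ₗ (coord V).symm.toLinearMap
  have h := hexp.map F (LinearMap.continuous_of_finiteDimensional F)
  have hF : ∀ E : End ℂ V, F (coord V E) = ℓ (E v) := fun E => by simp [F]
  have hcomp : F ∘ (fun k : ℕ => (k ! : ℂ)⁻¹ • coord V D ^ k) =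
      fun k : ℕ => (k ! : ℂ)⁻¹ * ℓ ((D ^ k) v) := by
    funext k
    rw [Function.comp_apply, map_smul, ← map_pow, hF, smul_eq_mul]
  rw [hcomp] at h
  exact h

lemma expGL_apply_of_apply_eq_smul {D : End ℂ V} {v : V} {c : ℂ} (h : D v = c • v) :
    (expGL D : End ℂ V) v = Complex.exp c • v := by
  have hpow : ∀ k : ℕ, (D ^ k) v = c ^ k • v := by
    intro k
    induction k with
    | zero => simp
    | succ k ih => rw [pow_succ', Module.End.mul_apply, ih, map_smul, h, smul_smul, pow_succ]
  rw [← sub_eq_zero, ← forall_dual_apply_eq_zero_iff ℂ]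
  intro ℓ
  rw [map_sub, sub_eq_zero]
  have h1 := hasSum_dual_expGL_apply D v ℓ
  have h2 : HasSum (fun k : ℕ => (k ! : ℂ)⁻¹ * c ^ k * ℓ v) (Complex.exp c * ℓ v) := by
    rw [Complex.exp_eq_exp_ℂ]
    exact (NormedSpace.exp_series_hasSum_exp' (𝕂 := ℂ) c).mul_right _
  simp only [hpow, map_smul, smul_eq_mul, ← mul_assoc] at h1 ⊢
  exact h1.unique h2

lemma dual_expGL_apply_of_pow_eq_zero {D : End ℂ V} {K : ℕ} (h : D ^ K = 0) (v : V)
    (ℓ : Dual ℂ V) :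
    ℓ ((expGL D : End ℂ V) v) = ∑ k ∈ Finset.range K, (k ! : ℂ)⁻¹ * ℓ ((D ^ k) v) :=
  (hasSum_dual_expGL_apply D v ℓ).unique <| hasSum_sum_of_ne_finset_zero fun k hk => by
    rw [pow_eq_zero_of_le (by simpa using hk) h]
    simp

/-- For commuting `s` semisimple and `n` nilpotent, the matrix coefficients of
`exp (w s + t n)` come from formal exponential polynomials. -/
lemma exists_expPoly_eval₂_eq {n s : End ℂ V} (hn : IsNilpotent n) (hs : s.IsSemisimple)
    (hns : Commute n s) (ℓ : Dual ℂ V) (v : V) :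
    ∃ r : ExpPoly, ∀ w t, ExpPoly.eval₂ w t r = ℓ ((expGL (t • n + w • s) : End ℂ V) v) := by
  obtain ⟨K, hK⟩ := hn
  induction (hs.iSup_eigenspace_eq_top ▸ Submodule.mem_top : v ∈ ⨆ μ, s.eigenspace μ) using
    Submodule.iSup_induction' with
  | zero => exact ⟨0, by simp⟩
  | add v₁ v₂ _ _ h₁ h₂ =>
    obtain ⟨r₁, h₁⟩ := h₁
    obtain ⟨r₂, h₂⟩ := h₂
    exact ⟨r₁ + r₂, fun w t => by rw [map_add, h₁, h₂, map_add, map_add]⟩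
  | mem μ v hv =>
    refine ⟨AddMonoidAlgebra.single μ
      (∑ k ∈ Finset.range K, C ((k ! : ℂ)⁻¹ * ℓ ((n ^ k) v)) * X ^ k), fun w t => ?_⟩
    have hw : (w • s) v = (μ * w) • v := by
      rw [LinearMap.smul_apply, End.mem_eigenspace_iff.1 hv, smul_smul, mul_comm]
    rw [expGL_add_of_commute ((hns.smul_left t).smul_right w), Units.val_mul,
      Module.End.mul_apply, expGL_apply_of_apply_eq_smul hw, map_smul, map_smul,
      dual_expGL_apply_of_pow_eq_zero (K := K) (by rw [_root_.smul_pow, hK, smul_zero]),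
      ExpPoly.eval₂_single, eval_finsetSum, smul_eq_mul, mul_comm]
    congr 1
    refine Finset.sum_congr rfl fun k _ => ?_
    simp only [eval_mul, eval_C, eval_pow, eval_X, _root_.smul_pow, LinearMap.smul_apply, map_smul,
      smul_eq_mul]
    ring

/-- The Lie algebra of a Zariski closed set contains, along with `n + s`, the nilpotent part `n`:
a polynomial vanishing on all `exp (z (n + s))` becomes a formal exponential polynomial vanishing
on the diagonal, hence identically, and so also at the points `exp (t n)`. -/
lemma nilpotent_part_mem_lieAlgebraOf {S : Set (LinearMap.GeneralLinearGroup ℂ V)}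
    {n s : End ℂ V} (hn : IsNilpotent n) (hs : s.IsSemisimple) (hns : Commute n s)
    (h : n + s ∈ lieAlgebraOf (zariskiClosure S)) : n ∈ lieAlgebraOf (zariskiClosure S) := by
  intro t p hp
  choose r hr using fun ij : Fin (finrank ℂ V) × Fin (finrank ℂ V) =>
    exists_expPoly_eval₂_eq hn hs hns ((finBasis ℂ V).coord ij.1) (finBasis ℂ V ij.2)
  have hcoord : ∀ w t, (fun ij : Fin (finrank ℂ V) × Fin (finrank ℂ V) =>
      coord V (expGL (t • n + w • s) : End ℂ V) ij.1 ij.2) =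
      fun ij => ExpPoly.eval₂ w t (r ij) := by
    intro w t
    funext ij
    rw [hr, coord, LinearMap.toMatrixAlgEquiv_apply, Basis.coord_apply]
  have h0 : MvPolynomial.aeval r p = 0 := ExpPoly.eq_zero_of_eval₂_diag _ fun z => by
    rw [ExpPoly.eval₂_aeval, ← hcoord, ← smul_add]
    exact h z p hp
  have h1 := congrArg (ExpPoly.eval₂ 0 t) h0
  rwa [ExpPoly.eval₂_aeval, ← hcoord, zero_smul, add_zero, map_zero] at h1

end JordanDecomposition

end Exponential

/-! ### Nil-invariant forms are invariant -/

section Inn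

variable {L : Type*} [LieRing L] [LieAlgebra ℂ L] [FiniteDimensional ℂ L]

lemma ad_mem_lieAlgebraOf_zariskiClosure_Inn (x : L) :
    LieAlgebra.ad ℂ L x ∈
      lieAlgebraOf (zariskiClosure (Inn L : Set (LinearMap.GeneralLinearGroup ℂ L))) := by
  intro t p hp
  rw [← map_smul]
  exact hp _ (Subgroup.subset_closure ⟨t • x, rfl⟩)

end Inn

end NilInvariant

theorem mainTheorem2 {L : Type*} [LieRing L] [LieAlgebra ℂ L] [FiniteDimensional ℂ L]
    (B : LinearMap.BilinForm ℂ L) (hsymm : B.IsSymm) (hnil : NilInvariant.IsNilInvariant B) :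
    B.lieInvariant L := by
  have hB : ∀ a : L, IsNilpotent (LieAlgebra.ad ℂ L a) →
      ∀ x y : L, B ⁅a, x⁆ y = -B x ⁅a, y⁆ := by
    intro a ha x y
    exact hnil _ (NilInvariant.ad_mem_lieAlgebraOf_zariskiClosure_Inn a) ha x y
  intro x y z
  -- Each part of the Jordan decomposition of `ad x` is skew.
  obtain ⟨n, hn', s, hs', hn, hs, hx⟩ :=
    (LieAlgebra.ad ℂ L x).exists_isNilpotent_isSemisimple
  have hns : Commute n s := (Algebra.commute_of_mem_adjoin_singleton_of_commute hn'
    (Algebra.commute_of_mem_adjoin_self hs').symm).symm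
  have hmem := NilInvariant.ad_mem_lieAlgebraOf_zariskiClosure_Inn x
  rw [hx] at hmem
  have h₁ : B (n y) z = -B y (n z) :=
    hnil n (NilInvariant.nilpotent_part_mem_lieAlgebraOf hn hs hns hmem) hn y z
  have h₂ := NilInvariant.semisimple_part_skew hB hsymm hn hs hns hx y z
  rw [← LieAlgebra.ad_apply ℂ L x y, ← LieAlgebra.ad_apply ℂ L x z, hx]
  simp only [LinearMap.add_apply, map_add, h₁, h₂, neg_add]
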